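/- Let $S$ be a closed topological surface with a cellular decomposition with finite set of edges (1-cells) $E$ and finite set of faces (2-cells) $F$; that is, $S$ is obtained from finitely many polygons, one for each $f\in F$ and each with at least one side, by gluing their sides in pairs, each pair of glued sides giving one edge. The two sides of an edge may lie on the same face. Let $\Phi:E\to(0,\frac{\pi}{2})$ be a weight. For $\phi\in(0,\frac{\pi}{2})$ and $k_1,k_2>0$, let $D_1,D_2\subset\mathbb{S}^2$ be two disks of radii $r_i=\operatorname{arccot}k_i\in(0,\frac{\pi}{2})$ (so that $\partial D_i$ has constant geodesic curvature $k_i$) such that $D_1\cap D_2$ is a bigon with interior angle $\phi$; this bigon is unique up to isometry. Let $\ell_\phi(k_1,k_2)$ be the length of its side on $\partial D_1$, and let $k_1\,\ell_\phi(k_1,k_2)$ be the total geodesic curvature of that side. A circle pattern metric on $S$ realizing $\Phi$ is given, up to isometry, by the vector $k=(k_f)_{f\in F}\in\mathbb{R}_{>0}^{F}$ of geodesic curvatures of its circles, and is identified with it. Its total geodesic curvature is the vector $L(k)\in\mathbb{R}^F$ with $$L_f(k)=\sum_{s} k_f\,\ell_{\Phi(e_s)}(k_f,k_{f_s}),$$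 where $s$ runs over the sides of the polygon $f$, $e_s$ is the edge formed by $s$, and $f_s$ is the face that contains the side glued to $s$. For $F'\subset F$ let $E_{F'}$ be the set of edges that lie on the boundary of at least one face in $F'$, and let $$\mathcal{L}_1=\Big\{L\in\mathbb{R}_{>0}^{F}\ \Big|\ \sum_{f\in F'}L_f<2\sum_{e\in E_{F'}}\Phi(e)\ \text{ for all } \emptyset\neq F'\subset F\Big\}.$$ Let $\hat L\in\mathcal{L}_1$. Then there is a unique circle pattern metric $\hat k\in\mathbb{R}_{>0}^{F}$ with total geodesic curvature $L(\hat k)=\hat L$. Moreover, for every $k(0)\in\mathbb{R}_{>0}^{F}$ the prescribed combinatorial Ricci flow $$\frac{dk_i}{dt}=-(L_i(k)-\hat L_i)\,k_i,\qquad i\in F,$$ has a solution $k(t)\in\mathbb{R}_{>0}^{F}$ with initial value $k(0)$ that exists for all $t\in[0,+\infty)$; it is unique (every solution in $\mathbb{R}_{>0}^F$ on an interval $[0,T)$ with the same initial value agrees with it there); and $k(t)\to\hat k$ as $t\to+\infty$. -/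

import Mathlib

open scoped Topology

noncomputable section

namespace CirclePattern

/-! ### Closed surfaces with a cellular decomposition -/

/-- The boundary point with parameter `s ∈ [0, 1]` on the `j`-th side of an `n`-gon. The `n`-gon is
modelled by the closed unit disk of `ℂ` with `n ≥ 1` equally spaced corners on the unit circle (so
monogons and bigons are allowed). -/
def polygonSide (n : ℕ) (j : Fin n) (s : unitInterval) : Metric.closedBall (0 : ℂ) 1 :=
  ⟨(Circle.exp (2 * Real.pi * ((j : ℝ) + (s : ℝ)) / (n : ℝ)) : ℂ), by
    rw [mem_closedBall_zero_iff, Circle.norm_coe]⟩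

/-- A finite family of polygons indexed by the set `F` of faces whose sides are matched in pairs.
`E` is the set of edges; `side (e, false)` and `side (e, true)` are the two polygon sides that are
glued to form the edge `e`. They may belong to the same polygon. All sides of all polygons occur,
each exactly once. -/
structure PolygonGluing (E F : Type*) where
  numSides : F → ℕ
  numSides_pos : ∀ f, 0 < numSides f
  side : E × Bool ≃ (f : F) × Fin (numSides f)
  /-- whether the two sides of an edge are identified with opposite directions -/
  reversed : E → Bool

namespace PolygonGluing

variable {E F : Type*} (P : PolygonGluing E F)

/-- The identifications of boundary points of the polygons. -/
inductive Glued : ((_ : F) × Metric.closedBall (0 : ℂ) 1) →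
    ((_ : F) × Metric.closedBall (0 : ℂ) 1) → Prop
  | edge (e : E) (s : unitInterval) :
      Glued
        ⟨(P.side (e, false)).1, polygonSide _ (P.side (e, false)).2 s⟩
        ⟨(P.side (e, true)).1,
          polygonSide _ (P.side (e, true)).2 (if P.reversed e then unitInterval.symm s else s)⟩

/-- The surface obtained from the disjoint union of the polygons by gluing the sides in pairs, with
the quotient topology. For finite `F` it is a closed surface, orientable or not. -/
def Surface : Type _ := Quot P.Glued

instance : TopologicalSpace P.Surface := inferInstanceAs (TopologicalSpace (Quot P.Glued))

end PolygonGluing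

/-- A cellular decomposition of `S` with edges (1-cells) `E` and faces (2-cells) `F`: a
homeomorphism of `S` with a surface glued from polygons. The open faces are the images of the
polygon interiors, the edges are the images of the open polygon sides. -/
structure CellularDecomposition (E F S : Type*) [TopologicalSpace S] extends
    PolygonGluing E F where
  homeo : toPolygonGluing.Surface ≃ₜ S

/-! ### Spherical bigons -/

/-- The point of the unit sphere at distance `r` from the north pole in the direction `ψ`. -/
def spherePoint (r ψ : ℝ) : EuclideanSpace ℝ (Fin 3) :=
  !₂[Real.sin r * Real.cos ψ, Real.sin r * Real.sin ψ, Real.cos r]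

/-- The open spherical disk of center `c` and radius `r` in the unit sphere. -/
def sphericalDisk (c : EuclideanSpace ℝ (Fin 3)) (r : ℝ) : Set (EuclideanSpace ℝ (Fin 3)) :=
  {x | x ∈ Metric.sphere (0 : EuclideanSpace ℝ (Fin 3)) 1 ∧ InnerProductGeometry.angle x c < r}

/-- The circle of spherical radius `r` about `spherePoint r 0`, parametrized by the angle `θ` at
that center. It passes through the north pole at `θ = 0`. -/
def circleParam (r θ : ℝ) : EuclideanSpace ℝ (Fin 3) :=
  Real.cos r • spherePoint r 0 +
    Real.sin r • (Real.cos θ • !₂[-Real.cos r, 0, Real.sin r] + Real.sin θ • !₂[0, 1, 0])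

/-- Two disks `D₁`, `D₂` of radii `r₁`, `r₂` are placed so that both boundary circles pass through
the north pole and the directions from there to the two centers form the angle `π - φ`; thus
`D₁ ∩ D₂` is a bigon with interior angle `φ`. `bigonSideLength φ r₁ r₂` is the length of the side of
this bigon that lies on `∂D₁`, that is, of the arc `∂D₁ ∩ D₂`. -/
def bigonSideLength (φ r₁ r₂ : ℝ) : ℝ :=
  ∫ θ in {θ | θ ∈ Set.Ioc (-Real.pi) Real.pi ∧
      circleParam r₁ θ ∈ sphericalDisk (spherePoint r₂ (Real.pi - φ)) r₂},
    ‖deriv (circleParam r₁) θ‖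

/-- The radius `r = arccot k ∈ (0, π/2]` of a spherical disk whose boundary has geodesic curvature
`k = cot r ≥ 0`. -/
def radius (k : ℝ) : ℝ := Real.pi / 2 - Real.arctan k

/-- The total geodesic curvature of the side lying on `∂D₁` of the bigon of angle `φ` formed by two
disks `D₁`, `D₂` whose boundaries have geodesic curvatures `k₁`, `k₂`. -/
def bigonSideCurvature (φ k₁ k₂ : ℝ) : ℝ :=
  bigonSideLength φ (radius k₁) (radius k₂) * k₁

/-! ### Total geodesic curvature and the prescribed flow -/

namespace PolygonGluing

variable {E F : Type*} (P : PolygonGluing E F)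

/-- The face on the side `b` of the edge `e`. -/
def faceAt (e : E) (b : Bool) : F := (P.side (e, b)).1

/-- The total geodesic curvature `L_f` of the face `f` for the circle pattern with angles `Φ` whose
circles have geodesic curvatures `k`: the sum over all sides of the polygon `f` of the total
geodesic curvature of the corresponding arc of the circle of `f`. -/
def totalCurvature (Φ : E → ℝ) (k : F → ℝ) (f : F) : ℝ :=
  ∑ j : Fin (P.numSides f),
    let h := P.side.symm ⟨f, j⟩
    bigonSideCurvature (Φ h.1) (k f) (k (P.faceAt h.1 (!h.2)))

/-- The set `E_{F'}` of edges that lie on the boundary of some face in `F'`. -/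
def edgesOf [Fintype E] (F' : Finset F) : Finset E :=
  open Classical in Finset.univ.filter fun e => ∃ f ∈ F', ∃ b, P.faceAt e b = f

/-- The set `𝓛₁` of admissible total geodesic curvatures. -/
def admissible [Fintype E] (Φ : E → ℝ) : Set (F → ℝ) :=
  {L | (∀ f, 0 < L f) ∧
    ∀ F' : Finset F, F'.Nonempty → ∑ f ∈ F', L f < 2 * ∑ e ∈ P.edgesOf F', Φ e}

/-- `k` is a circle pattern metric (given by the geodesic curvatures of its circles) whose total
geodesic curvature is `L`. -/
def HasTotalCurvature (Φ : E → ℝ) (L k : F → ℝ) : Prop :=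
  (∀ f, 0 < k f) ∧ ∀ f, P.totalCurvature Φ k f = L f

/-- `k` solves the flow `dkᵢ/dt = -(Lᵢ - L̂ᵢ) kᵢ` in the space of circle pattern metrics on the
time interval `I`, with initial value `k₀` at time `0`. -/
def IsFlowOn (Φ : E → ℝ) (Lhat k₀ : F → ℝ) (I : Set ℝ) (k : ℝ → F → ℝ) : Prop :=
  k 0 = k₀ ∧ ∀ t ∈ I, ∀ i, 0 < k t i ∧
    HasDerivWithinAt (fun s => k s i) (-(P.totalCurvature Φ (k t) i - Lhat i) * k t i) I t

end PolygonGluing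

end CirclePattern

end

/-!
Spherical trigonometry gives the total geodesic curvature of a bigon side in closed form:
`2 s arctan (τ / s)`, where `s = sin (arctan k₁)` and `τ = sin φ k₁ / (k₁ cos φ + k₂)` is
invariant under scaling of `(k₁, k₂)`. Hence it decreases in `k₂` and increases when both
curvatures are scaled up. In the coordinates `u = log k` the total curvature is therefore
off-diagonally antitone and strictly increasing along the diagonal. Such a map `g` is injective,
since comparing `u` with `v` where `u - v` is maximal shows that `g u ≤ g v` implies `u ≤ v`. The
same comparison against the shifts `v + c` is a maximum principle for the flow `u' = g v - g u`
and forces `u → v`.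

For existence, a subsolution `g u ≤ L̂` maximizing `∑ u_f` is a solution, so it suffices to bound
the subsolutions. They are closed under suprema; if they were unbounded, some would be arbitrarily
large exactly on a nonempty set `I` of faces. But then the total curvature of `I` tends to `2 ∑ Φ`
over the edges of `I`, each bigon with both sides in `I` contributing the angle sum `2 Φ` of its
limiting Euclidean bigon, in contradiction to `L̂ ∈ 𝓛₁`. The flow exists for all time because `g`
is bounded.
-/

namespace CirclePattern

section Bigon

open Real Set

theorem sin_pos_and_cos_pos {φ : ℝ} (hφ : φ ∈ Ioo 0 (π / 2)) : 0 < sin φ ∧ 0 < cos φ :=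
  ⟨sin_pos_of_pos_of_lt_pi hφ.1 (by linarith [hφ.2, pi_pos]),
    cos_pos_of_mem_Ioo ⟨by linarith [hφ.1, pi_pos], hφ.2⟩⟩

theorem norm_vec3_eq_one_iff {x y z : ℝ} : ‖!₂[x, y, z]‖ = 1 ↔ x ^ 2 + y ^ 2 + z ^ 2 = 1 := by
  simp [EuclideanSpace.norm_eq, Fin.sum_univ_three]

theorem norm_spherePoint (r ψ : ℝ) : ‖spherePoint r ψ‖ = 1 := by
  rw [spherePoint, norm_vec3_eq_one_iff]
  linear_combination sin r ^ 2 * sin_sq_add_cos_sq ψ + sin_sq_add_cos_sq r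

theorem circleParam_eq (r θ : ℝ) : circleParam r θ =
    !₂[sin r * cos r * (1 - cos θ), sin r * sin θ, cos r ^ 2 + sin r ^ 2 * cos θ] := by
  ext i
  fin_cases i <;> simp [circleParam, spherePoint] <;> ring

theorem norm_circleParam (r θ : ℝ) : ‖circleParam r θ‖ = 1 := by
  rw [circleParam_eq, norm_vec3_eq_one_iff]
  linear_combination sin r ^ 2 * sin_sq_add_cos_sq θ +
    (cos r ^ 2 + sin r ^ 2 * cos θ ^ 2 + 1) * sin_sq_add_cos_sq r

theorem norm_deriv_circleParam (r θ : ℝ) : ‖deriv (circleParam r) θ‖ = |sin r| := by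
  have h : HasDerivAt (circleParam r)
      (sin r • ((-sin θ) • !₂[-cos r, 0, sin r] + cos θ • !₂[0, 1, 0])) θ :=
    ((((hasDerivAt_cos θ).smul_const _).fun_add
      ((hasDerivAt_sin θ).smul_const _)).fun_const_smul _).const_add _
  have hvec : (-sin θ) • !₂[-cos r, 0, sin r] + cos θ • !₂[0, 1, 0] =
      !₂[sin θ * cos r, cos θ, -sin θ * sin r] := by
    ext i
    fin_cases i <;> simp
  have hnorm : ‖!₂[sin θ * cos r, cos θ, -sin θ * sin r]‖ = 1 := by
    rw [norm_vec3_eq_one_iff]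
    linear_combination sin θ ^ 2 * sin_sq_add_cos_sq r + sin_sq_add_cos_sq θ
  rw [h.deriv, hvec, norm_smul, hnorm, mul_one, norm_eq_abs]

theorem mem_sphericalDisk_iff {x c : EuclideanSpace ℝ (Fin 3)} (hx : ‖x‖ = 1) (hc : ‖c‖ = 1)
    {r : ℝ} (hr : r ∈ Icc 0 π) : x ∈ sphericalDisk c r ↔ cos r < inner ℝ x c := by
  have hangle : cos (InnerProductGeometry.angle x c) = inner ℝ x c := by
    rw [InnerProductGeometry.cos_angle, hx, hc, mul_one, div_one]
  rw [← hangle, strictAntiOn_cos.lt_iff_gt hr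
    ⟨InnerProductGeometry.angle_nonneg x c, InnerProductGeometry.angle_le_pi x c⟩]
  simp [sphericalDisk, hx]

theorem inner_circleParam_spherePoint (φ r₁ r₂ t : ℝ) :
    inner ℝ (circleParam r₁ (2 * t)) (spherePoint r₂ (π - φ)) = cos r₂ +
      2 * sin r₁ * (sin t * (sin r₂ * sin φ * cos t -
        (cos r₁ * sin r₂ * cos φ + sin r₁ * cos r₂) * sin t)) := by
  simp only [circleParam_eq, spherePoint, PiLp.inner_apply, Fin.sum_univ_three, cos_pi_sub,
    sin_pi_sub, sin_two_mul, cos_two_mul, RCLike.inner_apply, conj_trivial,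
    Matrix.cons_val]
  linear_combination cos r₂ * sin_sq_add_cos_sq r₁ +
    2 * sin r₁ * (cos r₁ * sin r₂ * cos φ + sin r₁ * cos r₂) * sin_sq_add_cos_sq t

theorem sin_mul_sub_pos_iff {A B t : ℝ} (hA : 0 < A) (hB : 0 < B)
    (ht : t ∈ Ioc (-(π / 2)) (π / 2)) :
    0 < sin t * (B * cos t - A * sin t) ↔ t ∈ Ioo 0 (arctan (B / A)) := by
  rcases ht.2.eq_or_lt with rfl | ht'
  · simp [hA.not_gt, (arctan_lt_pi_div_two _).not_gt]
  have hcos : 0 < cos t := cos_pos_of_mem_Ioo ⟨ht.1, ht'⟩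
  have htan : sin t * (B * cos t - A * sin t) = cos t ^ 2 * (tan t * (B - A * tan t)) := by
    rw [tan_eq_sin_div_cos]
    field_simp
  have hτ : tan t ∈ Ioo 0 (B / A) ↔ t ∈ Ioo 0 (arctan (B / A)) := by
    rw [mem_Ioo, mem_Ioo, ← arctan_pos (x := tan t), ← arctan_lt_arctan_iff (x := tan t),
      arctan_tan ht.1 ht']
  rw [htan, mul_pos_iff_of_pos_left (by positivity), ← hτ, mem_Ioo, lt_div_iff₀' hA]
  refine ⟨fun h => ?_, fun ⟨h₀, h₁⟩ => mul_pos h₀ (sub_pos.2 h₁)⟩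
  rcases mul_pos_iff.1 h with ⟨h₀, h₁⟩ | ⟨h₀, h₁⟩
  · exact ⟨h₀, sub_pos.1 h₁⟩
  · nlinarith

theorem setOf_circleParam_mem_sphericalDisk {φ r₁ r₂ : ℝ} (hφ : φ ∈ Ioo 0 (π / 2))
    (h₁ : r₁ ∈ Ioo 0 (π / 2)) (h₂ : r₂ ∈ Ioo 0 (π / 2)) :
    {θ | θ ∈ Ioc (-π) π ∧ circleParam r₁ θ ∈ sphericalDisk (spherePoint r₂ (π - φ)) r₂} =
      Ioo 0 (2 * arctan (sin r₂ * sin φ / (cos r₁ * sin r₂ * cos φ + sin r₁ * cos r₂))) := by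
  obtain ⟨hsφ, hcφ⟩ := sin_pos_and_cos_pos hφ
  obtain ⟨hs₁, hc₁⟩ := sin_pos_and_cos_pos h₁
  obtain ⟨hs₂, hc₂⟩ := sin_pos_and_cos_pos h₂
  ext θ
  obtain ⟨t, rfl⟩ : ∃ t, θ = 2 * t := ⟨θ / 2, by ring⟩
  have hdisk : circleParam r₁ (2 * t) ∈ sphericalDisk (spherePoint r₂ (π - φ)) r₂ ↔
      0 < sin t * (sin r₂ * sin φ * cos t -
        (cos r₁ * sin r₂ * cos φ + sin r₁ * cos r₂) * sin t) := by
    rw [mem_sphericalDisk_iff (norm_circleParam _ _) (norm_spherePoint _ _)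
      ⟨h₂.1.le, by linarith [h₂.2, pi_pos]⟩, inner_circleParam_spherePoint, lt_add_iff_pos_right,
      mul_pos_iff_of_pos_left (by positivity)]
  have hIoc : 2 * t ∈ Ioc (-π) π ↔ t ∈ Ioc (-(π / 2)) (π / 2) := by
    simp only [mem_Ioc]
    constructor <;> rintro ⟨_, _⟩ <;> constructor <;> linarith
  have hIoo (b : ℝ) : 2 * t ∈ Ioo 0 (2 * b) ↔ t ∈ Ioo 0 b := by simp [mem_Ioo]
  rw [mem_ofPred_eq, hdisk, hIoc, hIoo]
  constructor
  · rintro ⟨ht, hpos⟩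
    exact (sin_mul_sub_pos_iff (by positivity) (by positivity) ht).1 hpos
  · intro ht
    have ht' : t ∈ Ioc (-(π / 2)) (π / 2) :=
      ⟨by linarith [ht.1, pi_pos], (ht.2.trans (arctan_lt_pi_div_two _)).le⟩
    exact ⟨ht', (sin_mul_sub_pos_iff (by positivity) (by positivity) ht').2 ht⟩

theorem bigonSideLength_eq {φ r₁ r₂ : ℝ} (hφ : φ ∈ Ioo 0 (π / 2))
    (h₁ : r₁ ∈ Ioo 0 (π / 2)) (h₂ : r₂ ∈ Ioo 0 (π / 2)) :
    bigonSideLength φ r₁ r₂ = 2 * sin r₁ * arctan (sin r₂ * sin φ /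
      (cos r₁ * sin r₂ * cos φ + sin r₁ * cos r₂)) := by
  obtain ⟨hsφ, hcφ⟩ := sin_pos_and_cos_pos hφ
  obtain ⟨hs₁, hc₁⟩ := sin_pos_and_cos_pos h₁
  obtain ⟨hs₂, hc₂⟩ := sin_pos_and_cos_pos h₂
  have harc : 0 ≤ arctan (sin r₂ * sin φ / (cos r₁ * sin r₂ * cos φ + sin r₁ * cos r₂)) :=
    arctan_nonneg.2 (by positivity)
  rw [bigonSideLength, setOf_circleParam_mem_sphericalDisk hφ h₁ h₂]
  simp_rw [norm_deriv_circleParam, abs_of_pos hs₁]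
  rw [MeasureTheory.setIntegral_const, Real.volume_real_Ioo_of_le (mul_nonneg two_pos.le harc),
    smul_eq_mul]
  ring

/-- In the Euclidean bigon of angle `φ` bounded by circles of curvatures `k₁` and `k₂`, the tangent
of half the angle that the side on the first circle subtends at the centre of that circle. -/
noncomputable def planarHalfArcTan (φ k₁ k₂ : ℝ) : ℝ :=
  sin φ * k₁ / (k₁ * cos φ + k₂)

theorem bigonSideCurvature_eq {φ k₁ k₂ : ℝ} (hφ : φ ∈ Ioo 0 (π / 2)) (h₁ : 0 < k₁)
    (h₂ : 0 < k₂) :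
    bigonSideCurvature φ k₁ k₂ =
      2 * (sin (arctan k₁) * arctan (planarHalfArcTan φ k₁ k₂ / sin (arctan k₁))) := by
  have hradius {k : ℝ} (hk : 0 < k) : radius k ∈ Ioo 0 (π / 2) :=
    ⟨sub_pos.2 (arctan_lt_pi_div_two k), sub_lt_self _ (arctan_pos.2 hk)⟩
  have hcos : 0 < cos φ := (sin_pos_and_cos_pos hφ).2
  have htan : 1 / √(1 + k₂ ^ 2) * sin φ / (k₁ / √(1 + k₁ ^ 2) * (1 / √(1 + k₂ ^ 2)) * cos φ +
      1 / √(1 + k₁ ^ 2) * (k₂ / √(1 + k₂ ^ 2))) =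
        planarHalfArcTan φ k₁ k₂ / (k₁ / √(1 + k₁ ^ 2)) := by
    have : 0 < √(1 + k₁ ^ 2) := by positivity
    have : 0 < √(1 + k₂ ^ 2) := by positivity
    have : 0 < k₁ * cos φ + k₂ := by positivity
    rw [planarHalfArcTan]
    field_simp
  rw [bigonSideCurvature, bigonSideLength_eq hφ (hradius h₁) (hradius h₂)]
  simp only [radius, sin_pi_div_two_sub, cos_pi_div_two_sub, sin_arctan, cos_arctan]
  rw [htan]
  ring

theorem planarHalfArcTan_pos {φ k₁ k₂ : ℝ} (hφ : φ ∈ Ioo 0 (π / 2)) (h₁ : 0 < k₁)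
    (h₂ : 0 < k₂) : 0 < planarHalfArcTan φ k₁ k₂ := by
  obtain ⟨hsin, hcos⟩ := sin_pos_and_cos_pos hφ
  rw [planarHalfArcTan]
  positivity

theorem planarHalfArcTan_mul_mul (φ k₁ k₂ : ℝ) {c : ℝ} (hc : c ≠ 0) :
    planarHalfArcTan φ (c * k₁) (c * k₂) = planarHalfArcTan φ k₁ k₂ := by
  rw [planarHalfArcTan, mul_left_comm, mul_assoc c, ← mul_add, mul_div_mul_left _ _ hc,
    planarHalfArcTan]

theorem antitoneOn_planarHalfArcTan {φ k₁ : ℝ} (hφ : φ ∈ Ioo 0 (π / 2)) (h₁ : 0 < k₁) :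
    AntitoneOn (planarHalfArcTan φ k₁) (Ioi 0) := by
  intro k₂ h₂ k₂' _ h
  have h₂ : 0 < k₂ := h₂
  obtain ⟨hsin, hcos⟩ := sin_pos_and_cos_pos hφ
  unfold planarHalfArcTan
  gcongr

theorem planarHalfArcTan_le_div {φ k₁ k₂ : ℝ} (hφ : φ ∈ Ioo 0 (π / 2)) (h₁ : 0 < k₁)
    (h₂ : 0 < k₂) : planarHalfArcTan φ k₁ k₂ ≤ k₁ / k₂ := by
  have hcos : 0 < cos φ := (sin_pos_and_cos_pos hφ).2
  unfold planarHalfArcTan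
  gcongr
  · exact mul_le_of_le_one_left h₁.le (sin_le_one φ)
  · exact le_add_of_nonneg_left (by positivity)

/-- The two centres of a Euclidean bigon and one of its corners form a triangle with exterior
angle `φ` at the corner. -/
theorem arctan_planarHalfArcTan_add_swap {φ k₁ k₂ : ℝ} (hφ : φ ∈ Ioo 0 (π / 2)) (h₁ : 0 < k₁)
    (h₂ : 0 < k₂) :
    arctan (planarHalfArcTan φ k₁ k₂) + arctan (planarHalfArcTan φ k₂ k₁) = φ := by
  obtain ⟨hsin, hcos⟩ := sin_pos_and_cos_pos hφ
  have : 0 < k₁ * cos φ + k₂ := by positivity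
  have : 0 < k₂ * cos φ + k₁ := by positivity
  have hprod : 1 - planarHalfArcTan φ k₁ k₂ * planarHalfArcTan φ k₂ k₁ =
      cos φ * (k₁ ^ 2 + k₂ ^ 2 + 2 * k₁ * k₂ * cos φ) /
        ((k₁ * cos φ + k₂) * (k₂ * cos φ + k₁)) := by
    unfold planarHalfArcTan
    field_simp
    linear_combination (-(k₁ * k₂)) * sin_sq_add_cos_sq φ
  have hlt : planarHalfArcTan φ k₁ k₂ * planarHalfArcTan φ k₂ k₁ < 1 := by
    rw [← sub_pos, hprod]
    positivity
  have htan : (planarHalfArcTan φ k₁ k₂ + planarHalfArcTan φ k₂ k₁) /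
      (1 - planarHalfArcTan φ k₁ k₂ * planarHalfArcTan φ k₂ k₁) = tan φ := by
    rw [hprod, tan_eq_sin_div_cos]
    unfold planarHalfArcTan
    field_simp
    ring
  rw [arctan_add hlt, htan, arctan_tan (by linarith [hφ.1, pi_pos]) hφ.2]

theorem antitoneOn_bigonSideCurvature {φ k₁ : ℝ} (hφ : φ ∈ Ioo 0 (π / 2)) (h₁ : 0 < k₁) :
    AntitoneOn (bigonSideCurvature φ k₁) (Ioi 0) := by
  intro k₂ h₂ k₂' h₂' h
  have : 0 < sin (arctan k₁) := sin_arctan_pos.2 h₁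
  rw [bigonSideCurvature_eq hφ h₁ h₂, bigonSideCurvature_eq hφ h₁ h₂']
  gcongr
  exact antitoneOn_planarHalfArcTan hφ h₁ h₂ h₂' h

theorem strictAntiOn_arctan_div_self : StrictAntiOn (fun x => arctan x / x) (Ioi 0) := by
  have hconcave : StrictConcaveOn ℝ (Ici 0) arctan := by
    refine StrictAntiOn.strictConcaveOn_of_deriv (convex_Ici 0) continuous_arctan.continuousOn ?_
    rw [interior_Ici, Real.deriv_arctan]
    intro x hx y _ hxy
    have hx : 0 < x := hx
    dsimp only
    gcongr
  intro x hx y hy hxy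
  simpa only [arctan_zero, sub_zero] using hconcave.secant_strict_mono (mem_Ici.2 le_rfl)
    (mem_Ici.2 (le_of_lt hx)) (mem_Ici.2 (le_of_lt hy)) (ne_of_gt hx) (ne_of_gt hy) hxy

theorem strictMonoOn_mul_arctan_div {τ : ℝ} (hτ : 0 < τ) :
    StrictMonoOn (fun s => s * arctan (τ / s)) (Ioi 0) := by
  intro s hs s' hs' h
  have hs : 0 < s := hs
  have hs' : 0 < s' := hs'
  have hfactor {x : ℝ} (hx : 0 < x) : x * arctan (τ / x) = τ * (arctan (τ / x) / (τ / x)) := by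
    field_simp
  dsimp only
  rw [hfactor hs, hfactor hs']
  gcongr 1
  exact strictAntiOn_arctan_div_self (div_pos hτ hs') (div_pos hτ hs) (by gcongr)

theorem bigonSideCurvature_lt_mul_mul {φ k₁ k₂ c : ℝ} (hφ : φ ∈ Ioo 0 (π / 2)) (h₁ : 0 < k₁)
    (h₂ : 0 < k₂) (hc : 1 < c) :
    bigonSideCurvature φ k₁ k₂ < bigonSideCurvature φ (c * k₁) (c * k₂) := by
  have hc₀ : 0 < c := one_pos.trans hc
  have hsin : sin (arctan k₁) < sin (arctan (c * k₁)) :=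
    sin_arctan_strictMono (lt_mul_of_one_lt_left h₁ hc)
  rw [bigonSideCurvature_eq hφ h₁ h₂, bigonSideCurvature_eq hφ (by positivity) (by positivity),
    planarHalfArcTan_mul_mul φ k₁ k₂ hc₀.ne']
  gcongr 2 * ?_
  exact strictMonoOn_mul_arctan_div (planarHalfArcTan_pos hφ h₁ h₂) (sin_arctan_pos.2 h₁)
    (sin_arctan_pos.2 (by positivity)) hsin

theorem bigonSideCurvature_nonneg {φ k₁ k₂ : ℝ} (hφ : φ ∈ Ioo 0 (π / 2)) (h₁ : 0 < k₁)
    (h₂ : 0 < k₂) : 0 ≤ bigonSideCurvature φ k₁ k₂ := by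
  have hsin : 0 < sin (arctan k₁) := sin_arctan_pos.2 h₁
  have harctan : 0 ≤ arctan (planarHalfArcTan φ k₁ k₂ / sin (arctan k₁)) :=
    arctan_nonneg.2 (div_nonneg (planarHalfArcTan_pos hφ h₁ h₂).le hsin.le)
  rw [bigonSideCurvature_eq hφ h₁ h₂]
  positivity

theorem bigonSideCurvature_le_pi_mul_sin_arctan {φ k₁ k₂ : ℝ} (hφ : φ ∈ Ioo 0 (π / 2))
    (h₁ : 0 < k₁) (h₂ : 0 < k₂) : bigonSideCurvature φ k₁ k₂ ≤ π * sin (arctan k₁) := by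
  have : 0 < sin (arctan k₁) := sin_arctan_pos.2 h₁
  calc bigonSideCurvature φ k₁ k₂
      = 2 * (sin (arctan k₁) * arctan (planarHalfArcTan φ k₁ k₂ / sin (arctan k₁))) :=
        bigonSideCurvature_eq hφ h₁ h₂
    _ ≤ 2 * (sin (arctan k₁) * (π / 2)) := by
        gcongr
        exact (arctan_lt_pi_div_two _).le
    _ = π * sin (arctan k₁) := by ring

theorem bigonSideCurvature_le_pi {φ k₁ k₂ : ℝ} (hφ : φ ∈ Ioo 0 (π / 2)) (h₁ : 0 < k₁)
    (h₂ : 0 < k₂) : bigonSideCurvature φ k₁ k₂ ≤ π :=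
  (bigonSideCurvature_le_pi_mul_sin_arctan hφ h₁ h₂).trans
    (mul_le_of_le_one_right pi_pos.le (sin_le_one _))

theorem bigonSideCurvature_le_pi_mul {φ k₁ k₂ : ℝ} (hφ : φ ∈ Ioo 0 (π / 2)) (h₁ : 0 < k₁)
    (h₂ : 0 < k₂) : bigonSideCurvature φ k₁ k₂ ≤ π * k₁ := by
  have hle : arctan k₁ ≤ k₁ :=
    (le_tan (arctan_nonneg.2 h₁.le) (arctan_lt_pi_div_two k₁)).trans_eq (tan_arctan k₁)
  refine (bigonSideCurvature_le_pi_mul_sin_arctan hφ h₁ h₂).trans ?_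
  gcongr
  exact (sin_le (arctan_nonneg.2 h₁.le)).trans hle

theorem two_mul_sin_arctan_mul_le_bigonSideCurvature {φ N k₁ k₂ : ℝ} (hφ : φ ∈ Ioo 0 (π / 2))
    (hN : 0 < N) (h₁ : N ≤ k₁) (h₂ : 0 < k₂) :
    2 * (sin (arctan N) * arctan (planarHalfArcTan φ k₁ k₂)) ≤ bigonSideCurvature φ k₁ k₂ := by
  have hk₁ : 0 < k₁ := hN.trans_le h₁
  have hτ : 0 < planarHalfArcTan φ k₁ k₂ := planarHalfArcTan_pos hφ hk₁ h₂
  have hsin : 0 < sin (arctan k₁) := sin_arctan_pos.2 hk₁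
  have : 0 ≤ arctan (planarHalfArcTan φ k₁ k₂) := arctan_nonneg.2 hτ.le
  rw [bigonSideCurvature_eq hφ hk₁ h₂]
  gcongr
  · exact sin_arctan_strictMono.monotone h₁
  · exact le_div_self hτ.le hsin (sin_le_one _)

theorem two_mul_sin_arctan_mul_le_bigonSideCurvature_add_swap {φ N k₁ k₂ : ℝ}
    (hφ : φ ∈ Ioo 0 (π / 2)) (hN : 0 < N) (h₁ : N ≤ k₁) (h₂ : N ≤ k₂) :
    2 * (sin (arctan N) * φ) ≤ bigonSideCurvature φ k₁ k₂ + bigonSideCurvature φ k₂ k₁ := by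
  have hk₁ : 0 < k₁ := hN.trans_le h₁
  have hk₂ : 0 < k₂ := hN.trans_le h₂
  nth_rw 1 [← arctan_planarHalfArcTan_add_swap hφ hk₁ hk₂]
  rw [mul_add, mul_add]
  exact add_le_add (two_mul_sin_arctan_mul_le_bigonSideCurvature hφ hN h₁ hk₂)
    (two_mul_sin_arctan_mul_le_bigonSideCurvature hφ hN h₂ hk₁)

theorem two_mul_sin_arctan_mul_sub_le_bigonSideCurvature {φ N C k₁ k₂ : ℝ}
    (hφ : φ ∈ Ioo 0 (π / 2)) (hN : 0 < N) (h₁ : N ≤ k₁) (h₂ : 0 < k₂) (hC : k₂ ≤ C) :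
    2 * (sin (arctan N) * (φ - arctan (C / N))) ≤ bigonSideCurvature φ k₁ k₂ := by
  have hk₁ : 0 < k₁ := hN.trans_le h₁
  have hratio : planarHalfArcTan φ k₂ k₁ ≤ C / N :=
    (planarHalfArcTan_le_div hφ h₂ hk₁).trans (div_le_div₀ (h₂.le.trans hC) hC hN h₁)
  have hangle : φ - arctan (C / N) ≤ arctan (planarHalfArcTan φ k₁ k₂) := by
    linarith [arctan_planarHalfArcTan_add_swap hφ hk₁ h₂, arctan_mono hratio]
  have : 0 < sin (arctan N) := sin_arctan_pos.2 hN
  exact le_trans (by gcongr) (two_mul_sin_arctan_mul_le_bigonSideCurvature hφ hN h₁ h₂)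

theorem contDiff_bigonSideCurvature_exp {n : WithTop ℕ∞} {φ : ℝ} (hφ : φ ∈ Ioo 0 (π / 2)) :
    ContDiff ℝ n fun u : ℝ × ℝ => bigonSideCurvature φ (exp u.1) (exp u.2) := by
  have hcos := (sin_pos_and_cos_pos hφ).2
  have heq : (fun u : ℝ × ℝ => bigonSideCurvature φ (exp u.1) (exp u.2)) = fun u =>
      2 * (sin (arctan (exp u.1)) *
        arctan (planarHalfArcTan φ (exp u.1) (exp u.2) / sin (arctan (exp u.1)))) :=
    funext fun u => bigonSideCurvature_eq hφ (exp_pos _) (exp_pos _)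
  have hexp₁ : ContDiff ℝ n fun u : ℝ × ℝ => exp u.1 := contDiff_fst.exp
  have hexp₂ : ContDiff ℝ n fun u : ℝ × ℝ => exp u.2 := contDiff_snd.exp
  have hsin : ContDiff ℝ n fun u : ℝ × ℝ => sin (arctan (exp u.1)) :=
    (contDiff_arctan.comp hexp₁).sin
  have hτ : ContDiff ℝ n fun u : ℝ × ℝ => planarHalfArcTan φ (exp u.1) (exp u.2) :=
    (contDiff_const.mul hexp₁).div ((hexp₁.mul contDiff_const).add hexp₂) fun u => by positivity
  rw [heq]
  exact contDiff_const.mul (hsin.mul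
    (contDiff_arctan.comp (hτ.div hsin fun u => (sin_arctan_pos.2 (exp_pos u.1)).ne')))

end Bigon

section IntegralCurve

open Set Filter Bornology
open scoped Manifold ContDiff

variable {V : Type*} [NormedAddCommGroup V] [NormedSpace ℝ V] [ProperSpace V] {v : V → V}

theorem exists_isIntegralCurveOn_Icc (hv : ContDiff ℝ 1 v) (hbdd : IsBounded (range v)) (x₀ : V)
    {a : ℝ} (ha : 0 ≤ a) : ∃ x, x 0 = x₀ ∧ IsIntegralCurveOn x (fun _ => v) (Icc (-a) a) := by
  obtain ⟨B, hB, hvB⟩ := hbdd.exists_pos_norm_le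
  lift B to NNReal using hB.le
  lift a to NNReal using ha
  obtain ⟨K, hK⟩ := hv.contDiffOn.exists_lipschitzOnWith one_ne_zero
    (convex_closedBall x₀ (B * a)) (isCompact_closedBall x₀ _)
  have hPL : IsPicardLindelof (fun _ => v) (⟨0, by simp⟩ : Icc (-a : ℝ) a) x₀ (B * a) 0 B K :=
    { lipschitzOnWith := fun _ _ => mod_cast hK
      continuousOn := fun _ _ => continuousOn_const
      norm_le := fun _ _ x _ => hvB _ (mem_range_self x)
      mul_max_le := by simp }
  exact hPL.exists_eq_forall_mem_Icc_hasDerivWithinAt₀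

theorem exists_isIntegralCurve (hv : ContDiff ℝ 1 v) (hbdd : IsBounded (range v)) (x₀ : V) :
    ∃ x, x 0 = x₀ ∧ IsIntegralCurve x fun _ => v := by
  have hlocal (a : ℝ) : ∃ x, x 0 = x₀ ∧ IsMIntegralCurveOn (I := 𝓘(ℝ, V)) x v (Ioo (-a) a) := by
    obtain ⟨x, hx₀, hx⟩ := exists_isIntegralCurveOn_Icc hv hbdd x₀ (abs_nonneg a)
    have hsub : Ioo (-a) a ⊆ Icc (-|a|) |a| :=
      Ioo_subset_Icc_self.trans (Icc_subset_Icc (neg_le_neg (le_abs_self a)) (le_abs_self a))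
    exact ⟨x, hx₀, fun t ht => (hx.mono hsub t ht).hasFDerivWithinAt.hasMFDerivWithinAt⟩
  obtain ⟨x, hx₀, hx⟩ := (exists_isMIntegralCurve_iff_exists_isMIntegralCurveOn_Ioo
    (I := 𝓘(ℝ, V)) (contMDiff_vectorSpace_iff_contDiff.2 hv) x₀).2 hlocal
  exact ⟨x, hx₀, fun t =>
    hasDerivAt_iff_hasFDerivAt.2 (hasMFDerivAt_iff_hasFDerivAt.1 (hx t))⟩

theorem eqOn_Ico_of_isIntegralCurveOn (hv : ContDiff ℝ 1 v) {a b : ℝ} {x y : ℝ → V}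
    (hx : IsIntegralCurveOn x (fun _ => v) (Ico a b))
    (hy : IsIntegralCurveOn y (fun _ => v) (Ico a b)) (h : x a = y a) : EqOn x y (Ico a b) := by
  intro t ht
  have hsub : Icc a t ⊆ Ico a b := Icc_subset_Ico_right ht.2
  obtain ⟨R, hR⟩ : ∃ R, x '' Icc a t ∪ y '' Icc a t ⊆ Metric.closedBall 0 R :=
    ((isCompact_Icc.image_of_continuousOn (hx.continuousOn.mono hsub)).isBounded.union
      (isCompact_Icc.image_of_continuousOn (hy.continuousOn.mono hsub)).isBounded).subset_closedBall
        0
  obtain ⟨K, hK⟩ := hv.contDiffOn.exists_lipschitzOnWith one_ne_zero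
    (convex_closedBall 0 R) (isCompact_closedBall 0 R)
  have hright {z : ℝ → V} (hz : IsIntegralCurveOn z (fun _ => v) (Ico a b)) :
      ∀ s ∈ Ico a t, HasDerivWithinAt z (v (z s)) (Ici s) s := fun s hs =>
    (hz s (hsub (Ico_subset_Icc_self hs))).mono_of_mem_nhdsWithin
      (mem_of_superset (Ico_mem_nhdsGE (hs.2.trans ht.2)) (Ico_subset_Ico_left hs.1))
  exact ODE_solution_unique_of_mem_Icc_right (v := fun _ => v) (s := fun _ => Metric.closedBall 0 R)
    (fun _ _ => hK) (hx.continuousOn.mono hsub) (hright hx)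
    (fun s hs => hR (.inl (mem_image_of_mem x (Ico_subset_Icc_self hs))))
    (hy.continuousOn.mono hsub) (hright hy)
    (fun s hs => hR (.inr (mem_image_of_mem y (Ico_subset_Icc_self hs)))) h ⟨ht.1, le_rfl⟩

end IntegralCurve

section Comparison

open Set Filter

theorem eventually_lt_of_hasDerivWithinAt_neg {f : ℝ → ℝ} {f' t : ℝ}
    (hf : HasDerivWithinAt f f' (Ioi t) t) (hf' : f' < 0) : ∀ᶠ s in 𝓝[>] t, f s < f t := by
  rw [hasDerivWithinAt_iff_tendsto_slope' self_notMem_Ioi] at hf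
  filter_upwards [hf.eventually_lt_const hf', self_mem_nhdsWithin] with s hslope hs
  rw [slope_def_field, div_lt_iff₀ (sub_pos.2 hs), zero_mul] at hslope
  exact sub_neg.1 hslope

theorem nonpos_of_hasDerivWithinAt_neg {ι : Type*} [Finite ι] {z z' : ℝ → ι → ℝ} {a : ℝ}
    (hz : ∀ t ∈ Ici a, HasDerivWithinAt z (z' t) (Ici a) t) (ha : z a ≤ 0)
    (hneg : ∀ t ∈ Ici a, z t ≤ 0 → ∀ i, z t i = 0 → z' t i < 0) {t : ℝ} (ht : a ≤ t) :
    z t ≤ 0 := by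
  have := Fintype.ofFinite ι
  have hcont : ContinuousOn z (Icc a t) := fun s hs =>
    (hz s hs.1).continuousWithinAt.mono Icc_subset_Ici_self
  have hclosed : IsClosed ({s | z s ≤ 0} ∩ Icc a t) := by
    rw [inter_comm]
    exact hcont.preimage_isClosed_of_isClosed isClosed_Icc isClosed_Iic
  refine hclosed.Icc_subset_of_forall_mem_nhdsWithin ha ?_ ⟨ht, le_rfl⟩
  rintro s ⟨hs, hsa, -⟩
  refine eventually_all.2 fun i => ?_
  have hderiv : HasDerivWithinAt (fun r => z r i) (z' s i) (Ioi s) s :=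
    (hasDerivWithinAt_pi.1 (hz s hsa) i).mono (Ioi_subset_Ici hsa)
  rcases (hs i).eq_or_lt with hi | hi
  · filter_upwards [eventually_lt_of_hasDerivWithinAt_neg hderiv (hneg s hsa hs i hi)] with r hr
    exact hr.le.trans hi.le
  · filter_upwards [hderiv.continuousWithinAt.eventually_lt_const hi] with r hr using hr.le

/-- Off-diagonal antitonicity (Rheinboldt): the `i`-th component does not increase when coordinates
other than the `i`-th one do. -/
def OffDiagAntitone {ι α β : Type*} [Preorder α] [Preorder β] (g : (ι → α) → ι → β) : Prop :=
  ∀ ⦃u v⦄, u ≤ v → ∀ i, u i = v i → g v i ≤ g u i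

/-- Every component strictly increases when the same amount is added to all coordinates. -/
def DiagStrictMono {ι : Type*} (g : (ι → ℝ) → ι → ℝ) : Prop :=
  ∀ (u : ι → ℝ) (i : ι), StrictMono fun s => g (fun j => u j + s) i

theorem OffDiagAntitone.neg_comp_neg {ι : Type*} {g : (ι → ℝ) → ι → ℝ} (hg : OffDiagAntitone g) :
    OffDiagAntitone fun u => -g (-u) := fun _ _ huv i hi =>
  neg_le_neg (hg (neg_le_neg huv) i (congrArg Neg.neg hi.symm))

theorem DiagStrictMono.neg_comp_neg {ι : Type*} {g : (ι → ℝ) → ι → ℝ} (hg : DiagStrictMono g) :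
    DiagStrictMono fun u => -g (-u) := by
  intro u i s t hst
  have hneg (r : ℝ) : -(fun j => u j + r) = fun j => (-u) j + -r := funext fun j => neg_add _ _
  simpa only [Pi.neg_apply, neg_lt_neg_iff, hneg] using hg (-u) i (neg_lt_neg hst)

theorem OffDiagAntitone.supClosed_setOf_apply_le {ι α β : Type*} [LinearOrder α] [Preorder β]
    {g : (ι → α) → ι → β} (hg : OffDiagAntitone g) (a : ι → α) (L : ι → β) :
    SupClosed {u | a ≤ u ∧ g u ≤ L} := by
  rintro u ⟨hau, hu⟩ v ⟨-, hv⟩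
  refine ⟨hau.trans le_sup_left, fun i => ?_⟩
  rcases le_total (u i) (v i) with h | h
  · exact (hg le_sup_right i (sup_eq_right.2 h).symm).trans (hv i)
  · exact (hg le_sup_left i (sup_eq_left.2 h).symm).trans (hu i)

theorem exists_finset_le_of_not_bddAbove {ι α : Type*} [Finite ι] [LinearOrder α] [Nonempty α]
    {S : Set (ι → α)} (hS : SupClosed S) (h : ¬BddAbove S) :
    ∃ I : Finset ι, I.Nonempty ∧
      ∃ C, ∀ N, ∃ u ∈ S, (∀ i ∈ I, N ≤ u i) ∧ ∀ i ∉ I, u i ≤ C := by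
  set J : Set ι := {i | ¬BddAbove (Function.eval i '' S)} with hJ
  have hmem (i : ι) : i ∈ J.toFinite.toFinset ↔ ¬BddAbove (Function.eval i '' S) := by simp [hJ]
  have hne : J.toFinite.toFinset.Nonempty := by
    simpa only [Finset.Nonempty, hmem, bddAbove_pi, not_forall] using h
  obtain ⟨C, hC⟩ : BddAbove (⋃ i ∈ Jᶜ, Function.eval i '' S) :=
    Jᶜ.toFinite.bddAbove_biUnion.2 fun _ hi => not_not.1 hi
  refine ⟨J.toFinite.toFinset, hne, C, fun N => ?_⟩
  have hlarge (i : ι) (hi : i ∈ J.toFinite.toFinset) : ∃ u ∈ S, N ≤ u i := by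
    obtain ⟨_, ⟨u, hu, rfl⟩, hN⟩ := not_bddAbove_iff.1 ((hmem i).1 hi) N
    exact ⟨u, hu, hN.le⟩
  choose! u hu hN using hlarge
  have hsup : J.toFinite.toFinset.sup' hne u ∈ S := hS.finsetSup'_mem hne hu
  refine ⟨_, hsup, fun i hi => (hN i hi).trans (Finset.le_sup' u hi i), fun i hi => hC ?_⟩
  exact mem_biUnion (mt (hmem i).2 hi) (mem_image_of_mem _ hsup)

theorem OffDiagAntitone.exists_apply_eq {ι : Type*} [Finite ι] {g : (ι → ℝ) → ι → ℝ}
    (hg : OffDiagAntitone g) (hcont : Continuous g) {a L : ι → ℝ} (ha : g a ≤ L)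
    (hbdd : BddAbove {u | a ≤ u ∧ g u ≤ L}) : ∃ u, g u = L := by
  classical
  have := Fintype.ofFinite ι
  obtain ⟨c, hc⟩ := hbdd
  have hcompact : IsCompact {u | a ≤ u ∧ g u ≤ L} :=
    (isCompact_Icc (a := a) (b := c)).of_isClosed_subset
      ((isClosed_le continuous_const continuous_id).inter (isClosed_le hcont continuous_const))
      fun u hu => ⟨hu.1, hc hu⟩
  obtain ⟨u, hu, hmax⟩ := hcompact.exists_isMaxOn ⟨a, le_rfl, ha⟩
    (f := fun u => ∑ i, u i) (by fun_prop)
  refine ⟨u, hu.2.antisymm fun i => le_of_not_gt fun hlt => ?_⟩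
  obtain ⟨s, hs, hus⟩ : ∃ s, g (Function.update u i s) i < L i ∧ u i < s := by
    have hcont_i : Continuous fun s => g (Function.update u i s) i := by fun_prop
    have hev : ∀ᶠ s in 𝓝[>] u i, g (Function.update u i s) i < L i :=
      hcont_i.continuousWithinAt.eventually_lt_const (by simpa using hlt)
    exact (hev.and self_mem_nhdsWithin).exists
  have hle : u ≤ Function.update u i s := le_update_iff.2 ⟨hus.le, fun _ _ => le_rfl⟩
  have hsub : g (Function.update u i s) ≤ L := by
    intro j
    rcases eq_or_ne j i with rfl | hj
    · exact hs.le
    · exact (hg hle j (Function.update_of_ne hj _ _).symm).trans (hu.2 j)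
  have hsum : ∑ j, u j < ∑ j, Function.update u i s j :=
    Finset.sum_lt_sum (fun j _ => hle j) ⟨i, Finset.mem_univ i, by simpa using hus⟩
  exact hsum.not_ge (hmax ⟨hu.1.trans hle, hsub⟩)

section Flow

variable {ι : Type*} {g : (ι → ℝ) → ι → ℝ}
  (hanti : OffDiagAntitone g) (hmono : DiagStrictMono g)

include hanti hmono

theorem le_of_apply_le [Finite ι] {u v : ι → ℝ} (h : g u ≤ g v) : u ≤ v := by
  intro j
  have : Nonempty ι := ⟨j⟩
  obtain ⟨i, hi⟩ := Finite.exists_max fun i => u i - v i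
  refine sub_nonpos.1 ((hi j).trans (le_of_not_gt fun hpos => ?_))
  have hshift : u ≤ fun j => v j + (u i - v i) := fun j => sub_le_iff_le_add'.1 (hi j)
  refine (h i).not_gt ?_
  calc g v i = g (fun j => v j + 0) i := by simp only [add_zero]
    _ < g (fun j => v j + (u i - v i)) i := hmono v i hpos
    _ ≤ g u i := hanti hshift i (add_sub_cancel _ _).symm

theorem injective_of_offDiagAntitone [Finite ι] : Function.Injective g := fun _ _ h =>
  (le_of_apply_le hanti hmono h.le).antisymm (le_of_apply_le hanti hmono h.ge)

variable [Fintype ι] {v : ι → ℝ} {u : ℝ → ι → ℝ}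

omit hmono in
theorem le_add_barrier {b b' : ℝ → ℝ}
    (hu : IsIntegralCurveOn u (fun _ w => g v - g w) (Ici 0))
    (hb : ∀ t ∈ Ici 0, HasDerivWithinAt b (b' t) (Ici 0) t) (h0 : ∀ i, u 0 i ≤ v i + b 0)
    (hlt : ∀ t ∈ Ici 0, ∀ i, g v i - g (fun j => v j + b t) i < b' t) {t : ℝ} (ht : 0 ≤ t)
    (i : ι) : u t i ≤ v i + b t := by
  have hz (s : ℝ) (hs : s ∈ Ici (0 : ℝ)) : HasDerivWithinAt (fun r i => u r i - (v i + b r))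
      (fun i => (g v - g (u s)) i - b' s) (Ici 0) s := hasDerivWithinAt_pi.2 fun i =>
    (hasDerivWithinAt_pi.1 (hu s hs) i).sub ((hb s hs).const_add (v i))
  refine sub_nonpos.1 (nonpos_of_hasDerivWithinAt_neg hz (fun i => sub_nonpos.2 (h0 i)) ?_ ht i)
  intro s hs hle i hi
  have htouch : g (fun j => v j + b s) i ≤ g (u s) i :=
    hanti (fun j => sub_nonpos.1 (hle j)) i (sub_eq_zero.1 hi)
  exact sub_neg.2 ((sub_le_sub_left htouch _).trans_lt (hlt s hs i))

theorem eventually_le_add (hu : IsIntegralCurveOn u (fun _ w => g v - g w) (Ici 0)) {ε : ℝ}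
    (hε : 0 < ε) : ∀ᶠ t in atTop, ∀ i, u t i ≤ v i + ε := by
  obtain ⟨δ, hδ, hδ₀⟩ : ∃ δ, (∀ i, δ < g (fun j => v j + ε / 2) i - g v i) ∧ 0 < δ := by
    have hgap (i : ι) : 0 < g (fun j => v j + ε / 2) i - g v i := by
      simpa only [add_zero, sub_pos] using hmono v i (half_pos hε)
    have hev : ∀ᶠ δ in 𝓝[>] (0 : ℝ), ∀ i, δ < g (fun j => v j + ε / 2) i - g v i :=
      eventually_all.2 fun i => (eventually_lt_nhds (hgap i)).filter_mono nhdsWithin_le_nhds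
    exact (hev.and self_mem_nhdsWithin).exists
  obtain ⟨M, hM, hM₀⟩ : ∃ M, (∀ i, u 0 i - v i ≤ M) ∧ 0 < M :=
    ((eventually_all.2 fun i => eventually_ge_atTop _).and (eventually_gt_atTop 0)).exists
  set c := δ / M
  have hc : 0 < c := div_pos hδ₀ hM₀
  set b : ℝ → ℝ := fun t => ε / 2 + M * Real.exp (-c * t)
  have hb (t : ℝ) : HasDerivAt b (-δ * Real.exp (-c * t)) t := by
    refine ((((hasDerivAt_id' t).const_mul (-c)).exp.const_mul M).const_add _).congr_deriv ?_
    simp only [c]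
    field_simp
  have hbarrier (t : ℝ) (ht : 0 ≤ t) (i : ι) : u t i ≤ v i + b t := by
    refine le_add_barrier hanti hu (fun s _ => (hb s).hasDerivWithinAt) (fun j => ?_)
      (fun s hs j => ?_) ht i
    · simp only [b, mul_zero, Real.exp_zero, mul_one]
      linarith [hM j]
    · have hshift : g (fun k => v k + ε / 2) j ≤ g (fun k => v k + b s) j :=
        (hmono v j).monotone (le_add_of_nonneg_right (by positivity))
      have hexp : Real.exp (-c * s) ≤ 1 :=
        Real.exp_le_one_iff.2 (mul_nonpos_of_nonpos_of_nonneg (neg_nonpos.2 hc.le) hs)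
      nlinarith [hδ j]
  have hlim : Tendsto b atTop (𝓝 (ε / 2)) := by
    have hexp : Tendsto (fun t => Real.exp (-c * t)) atTop (𝓝 0) := Real.tendsto_exp_atBot.comp
      (tendsto_id.const_mul_atTop_of_neg (neg_lt_zero.2 hc))
    simpa only [mul_zero, add_zero] using (hexp.const_mul M).const_add (ε / 2)
  filter_upwards [hlim.eventually_lt_const (half_lt_self hε), eventually_ge_atTop 0]
    with t hbt ht i
  exact (hbarrier t ht i).trans (by gcongr)

theorem tendsto_of_isIntegralCurveOn
    (hu : IsIntegralCurveOn u (fun _ w => g v - g w) (Ici 0)) : Tendsto u atTop (𝓝 v) := by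
  have hneg : IsIntegralCurveOn (-u) (fun _ w => -g (-(-v)) - -g (-w)) (Ici 0) := fun t ht =>
    (hu t ht).neg.congr_deriv (by simp only [Pi.neg_apply, neg_neg]; abel)
  refine tendsto_pi_nhds.2 fun i => Metric.tendsto_nhds.2 fun ε hε => ?_
  filter_upwards [eventually_le_add hanti hmono hu (half_pos hε),
    eventually_le_add hanti.neg_comp_neg hmono.neg_comp_neg hneg (half_pos hε)] with t hle hge
  have hge_i : -u t i ≤ -v i + ε / 2 := hge i
  rw [Real.dist_eq, abs_lt]
  constructor <;> linarith [hle i]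

end Flow

end Comparison

namespace PolygonGluing

open Real Set Filter

variable {E F : Type*} (P : PolygonGluing E F) {Φ : E → ℝ}

theorem sum_totalCurvature [Fintype E] [DecidableEq F] (Φ : E → ℝ) (k : F → ℝ) (I : Finset F) :
    ∑ f ∈ I, P.totalCurvature Φ k f = ∑ e, ∑ b, if P.faceAt e b ∈ I then
      bigonSideCurvature (Φ e) (k (P.faceAt e b)) (k (P.faceAt e !b)) else 0 := by
  let c (h : E × Bool) : ℝ :=
    bigonSideCurvature (Φ h.1) (k (P.faceAt h.1 h.2)) (k (P.faceAt h.1 !h.2))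
  calc ∑ f ∈ I, P.totalCurvature Φ k f
      = ∑ x ∈ I.sigma fun _ => Finset.univ, c (P.side.symm x) := by
        rw [Finset.sum_sigma]
        simp only [c, totalCurvature, faceAt, Prod.mk.eta, Equiv.apply_symm_apply]
    _ = ∑ h with P.faceAt h.1 h.2 ∈ I, c h :=
        Finset.sum_equiv P.side.symm (by simp [faceAt]) fun _ _ => rfl
    _ = _ := by rw [Finset.sum_filter, Fintype.sum_prod_type]

/-- The total geodesic curvature as a function of the logarithms `u` of the geodesic curvatures. In
these coordinates the flow is the autonomous system `u' = L̂ - L(u)` on all of `ℝ^F`. -/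
noncomputable def logCurvature (Φ : E → ℝ) (u : F → ℝ) : F → ℝ :=
  P.totalCurvature Φ fun i => exp (u i)

theorem logCurvature_apply (Φ : E → ℝ) (u : F → ℝ) (f : F) :
    P.logCurvature Φ u f = ∑ j, bigonSideCurvature (Φ (P.side.symm ⟨f, j⟩).1) (exp (u f))
      (exp (u (P.faceAt (P.side.symm ⟨f, j⟩).1 !(P.side.symm ⟨f, j⟩).2))) :=
  rfl

theorem logCurvature_log {k : F → ℝ} (hk : ∀ f, 0 < k f) :
    P.logCurvature Φ (fun f => log (k f)) = P.totalCurvature Φ k := by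
  simp only [logCurvature, exp_log (hk _)]

section Flow

variable {L k₀ : F → ℝ} {I : Set ℝ}

theorem IsFlowOn.mono {P : PolygonGluing E F} {J : Set ℝ} {k : ℝ → F → ℝ}
    (hk : P.IsFlowOn Φ L k₀ I k) (hJ : J ⊆ I) : P.IsFlowOn Φ L k₀ J k :=
  ⟨hk.1, fun t ht f => ⟨(hk.2 t (hJ ht) f).1, (hk.2 t (hJ ht) f).2.mono hJ⟩⟩

variable [Fintype F]

theorem IsFlowOn.isIntegralCurveOn_log {P : PolygonGluing E F} {k : ℝ → F → ℝ}
    (hk : P.IsFlowOn Φ L k₀ I k) :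
    IsIntegralCurveOn (fun t f => log (k t f)) (fun _ u => L - P.logCurvature Φ u) I := by
  refine fun t ht => hasDerivWithinAt_pi.2 fun f => ?_
  obtain ⟨hpos, hderiv⟩ := hk.2 t ht f
  refine (hderiv.log hpos.ne').congr_deriv ?_
  simp only [P.logCurvature_log fun f => (hk.2 t ht f).1, mul_div_cancel_right₀ _ hpos.ne', neg_sub,
    Pi.sub_apply]

theorem isFlowOn_exp {u : ℝ → F → ℝ} (h0 : ∀ f, exp (u 0 f) = k₀ f)
    (hu : IsIntegralCurveOn u (fun _ w => L - P.logCurvature Φ w) I) :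
    P.IsFlowOn Φ L k₀ I fun t f => exp (u t f) := by
  refine ⟨funext h0, fun t ht f => ⟨exp_pos _, ?_⟩⟩
  refine (hasDerivWithinAt_pi.1 (hu t ht) f).exp.congr_deriv ?_
  simp only [Pi.sub_apply, logCurvature, neg_sub, mul_comm]

end Flow

section Bounds

variable (hΦ : ∀ e, Φ e ∈ Ioo 0 (π / 2))

include hΦ

theorem offDiagAntitone_logCurvature : OffDiagAntitone (P.logCurvature Φ) := by
  intro u v huv f hf
  rw [logCurvature_apply, logCurvature_apply, hf]
  exact Finset.sum_le_sum fun j _ => antitoneOn_bigonSideCurvature (hΦ _) (exp_pos _) (exp_pos _)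
    (exp_pos _) (exp_le_exp.2 (huv _))

theorem diagStrictMono_logCurvature : DiagStrictMono (P.logCurvature Φ) := by
  intro u f s t hst
  have : NeZero (P.numSides f) := ⟨(P.numSides_pos f).ne'⟩
  have hexp (i : F) : exp (u i + t) = exp (t - s) * exp (u i + s) := by
    rw [← exp_add]
    ring_nf
  simp only [logCurvature_apply, hexp]
  exact Finset.sum_lt_sum_of_nonempty Finset.univ_nonempty fun j _ =>
    bigonSideCurvature_lt_mul_mul (hΦ _) (exp_pos _) (exp_pos _) (one_lt_exp_iff.2 (sub_pos.2 hst))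

theorem contDiff_logCurvature [Fintype F] {n : WithTop ℕ∞} :
    ContDiff ℝ n (P.logCurvature Φ) := by
  have hside (f i : F) (e : E) : ContDiff ℝ n fun u : F → ℝ =>
      bigonSideCurvature (Φ e) (exp (u f)) (exp (u i)) := by
    have hcoord : ContDiff ℝ n fun u : F → ℝ => (u f, u i) :=
      (contDiff_apply ℝ ℝ f).prodMk (contDiff_apply ℝ ℝ i)
    simpa only [Function.comp_def] using
      (contDiff_bigonSideCurvature_exp (n := n) (hΦ e)).comp hcoord
  refine contDiff_pi.2 fun f => ?_
  simp only [logCurvature_apply]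
  exact ContDiff.sum fun j _ => hside f _ _

theorem logCurvature_mem_Icc (u : F → ℝ) :
    P.logCurvature Φ u ∈ Icc 0 fun f => P.numSides f * π := by
  refine ⟨fun f => ?_, fun f => ?_⟩ <;> rw [logCurvature_apply]
  · exact Finset.sum_nonneg fun j _ => bigonSideCurvature_nonneg (hΦ _) (exp_pos _) (exp_pos _)
  · refine (Finset.sum_le_card_nsmul _ _ π fun j _ =>
      bigonSideCurvature_le_pi (hΦ _) (exp_pos _) (exp_pos _)).trans_eq ?_
    rw [Finset.card_fin, nsmul_eq_mul]

theorem logCurvature_le_mul_exp (u : F → ℝ) (f : F) :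
    P.logCurvature Φ u f ≤ P.numSides f * (π * exp (u f)) := by
  rw [logCurvature_apply]
  refine (Finset.sum_le_card_nsmul _ _ (π * exp (u f)) fun j _ =>
    bigonSideCurvature_le_pi_mul (hΦ _) (exp_pos _) (exp_pos _)).trans_eq ?_
  rw [Finset.card_fin, nsmul_eq_mul]

theorem le_sum_totalCurvature [Fintype E] {k : F → ℝ} (hk : ∀ f, 0 < k f) {I : Finset F}
    {C N : ℝ} (hC : 0 ≤ C) (hN : 0 < N) (hI : ∀ f ∈ I, N ≤ k f) (hI' : ∀ f ∉ I, k f ≤ C) :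
    2 * ∑ e ∈ P.edgesOf I, sin (arctan N) * (Φ e - arctan (C / N)) ≤
      ∑ f ∈ I, P.totalCurvature Φ k f := by
  classical
  have hmem (e : E) : e ∈ P.edgesOf I ↔ P.faceAt e false ∈ I ∨ P.faceAt e true ∈ I := by
    simp [edgesOf]
  have hside (e : E) (b : Bool) (h : P.faceAt e b ∈ I) (h' : P.faceAt e (!b) ∉ I) :
      2 * (sin (arctan N) * (Φ e - arctan (C / N))) ≤
        bigonSideCurvature (Φ e) (k (P.faceAt e b)) (k (P.faceAt e !b)) :=
    two_mul_sin_arctan_mul_sub_le_bigonSideCurvature (hΦ e) hN (hI _ h) (hk _) (hI' _ h')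
  have hpair (e : E) (h₁ : P.faceAt e true ∈ I) (h₀ : P.faceAt e false ∈ I) :
      2 * (sin (arctan N) * (Φ e - arctan (C / N))) ≤
        bigonSideCurvature (Φ e) (k (P.faceAt e true)) (k (P.faceAt e false)) +
          bigonSideCurvature (Φ e) (k (P.faceAt e false)) (k (P.faceAt e true)) := by
    have : 0 ≤ sin (arctan N) := sin_arctan_nonneg.2 hN.le
    refine le_trans ?_ (two_mul_sin_arctan_mul_le_bigonSideCurvature_add_swap (hΦ e) hN
      (hI _ h₁) (hI _ h₀))
    gcongr
    exact sub_le_self _ (arctan_nonneg.2 (div_nonneg hC hN.le))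
  rw [P.sum_totalCurvature, Finset.mul_sum, ← Finset.sum_ite_mem_eq]
  refine Finset.sum_le_sum fun e _ => ?_
  rw [Fintype.sum_bool]
  by_cases h₁ : P.faceAt e true ∈ I <;> by_cases h₀ : P.faceAt e false ∈ I <;>
    simp only [hmem, h₁, h₀, or_self, or_true, true_or, if_true, if_false, add_zero, zero_add,
      le_refl, Bool.not_true, Bool.not_false]
  · exact hpair e h₁ h₀
  · exact hside e true h₁ h₀
  · exact hside e false h₀ h₁

theorem bddAbove_setOf_logCurvature_le [Fintype E] [Finite F] {L : F → ℝ}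
    (hL : L ∈ P.admissible Φ) (a : F → ℝ) : BddAbove {u | a ≤ u ∧ P.logCurvature Φ u ≤ L} := by
  by_contra hunbdd
  obtain ⟨I, hI, C, hC⟩ := exists_finset_le_of_not_bddAbove
    ((P.offDiagAntitone_logCurvature hΦ).supClosed_setOf_apply_le a L) hunbdd
  have hlim : Tendsto (fun N : ℝ => 2 * ∑ e ∈ P.edgesOf I,
      sin (arctan (exp N)) * (Φ e - arctan (exp C / exp N))) atTop
        (𝓝 (2 * ∑ e ∈ P.edgesOf I, Φ e)) := by
    have hsin : Tendsto (fun N => sin (arctan (exp N))) atTop (𝓝 1) := by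
      rw [← sin_pi_div_two]
      exact (continuous_sin.tendsto _).comp
        ((tendsto_arctan_atTop.mono_right nhdsWithin_le_nhds).comp tendsto_exp_atTop)
    have harctan : Tendsto (fun N => arctan (exp C / exp N)) atTop (𝓝 0) := by
      rw [← arctan_zero]
      exact (continuous_arctan.tendsto _).comp (tendsto_exp_atTop.const_div_atTop (exp C))
    simpa using (tendsto_finsetSum (P.edgesOf I) fun e _ =>
      hsin.mul (harctan.const_sub (Φ e))).const_mul 2
  obtain ⟨N, hN⟩ := (hlim.eventually_const_lt (hL.2 I hI)).exists
  obtain ⟨u, ⟨-, hu⟩, hlarge, hsmall⟩ := hC N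
  refine (Finset.sum_le_sum fun f _ => hu f).not_gt (hN.trans_le ?_)
  exact P.le_sum_totalCurvature hΦ (fun f => exp_pos (u f)) (exp_pos C).le (exp_pos N)
    (fun f hf => exp_le_exp.2 (hlarge f hf)) fun f hf => exp_le_exp.2 (hsmall f hf)

theorem exists_logCurvature_eq [Fintype E] [Finite F] {L : F → ℝ} (hL : L ∈ P.admissible Φ) :
    ∃ u, P.logCurvature Φ u = L := by
  have := Fintype.ofFinite F
  have hsub : P.logCurvature Φ (fun f => log (L f / (P.numSides f * π))) ≤ L := by
    intro f
    have hn : 0 < P.numSides f * π := mul_pos (Nat.cast_pos.2 (P.numSides_pos f)) pi_pos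
    calc _ ≤ P.numSides f * (π * exp (log (L f / (P.numSides f * π)))) :=
          P.logCurvature_le_mul_exp hΦ _ f
      _ = L f := by rw [exp_log (div_pos (hL.1 f) hn), ← mul_assoc, mul_div_cancel₀ _ hn.ne']
  exact (P.offDiagAntitone_logCurvature hΦ).exists_apply_eq
    (P.contDiff_logCurvature hΦ (n := 0)).continuous hsub
    (P.bddAbove_setOf_logCurvature_le hΦ hL _)

theorem isBounded_range_sub_logCurvature [Finite F] (L : F → ℝ) :
    Bornology.IsBounded (range fun u => L - P.logCurvature Φ u) :=
  have := Fintype.ofFinite F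
  (Metric.isBounded_Icc (L - fun f => P.numSides f * π) (L - 0)).subset <|
    range_subset_iff.2 fun u => ⟨sub_le_sub_left (P.logCurvature_mem_Icc hΦ u).2 L,
      sub_le_sub_left (P.logCurvature_mem_Icc hΦ u).1 L⟩

theorem eq_exp_of_hasTotalCurvature [Finite F] {u k : F → ℝ}
    (hk : P.HasTotalCurvature Φ (P.logCurvature Φ u) k) : k = fun f => exp (u f) := by
  have hlog : (fun f => log (k f)) = u :=
    injective_of_offDiagAntitone (P.offDiagAntitone_logCurvature hΦ)
      (P.diagStrictMono_logCurvature hΦ) ((P.logCurvature_log hk.1).trans (funext hk.2))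
  simp only [← hlog, exp_log (hk.1 _)]

theorem exists_isIntegralCurve_sub_logCurvature [Fintype F] (L u₀ : F → ℝ) :
    ∃ u, u 0 = u₀ ∧ IsIntegralCurve u fun _ w => L - P.logCurvature Φ w :=
  exists_isIntegralCurve (contDiff_const.sub (P.contDiff_logCurvature hΦ))
    (P.isBounded_range_sub_logCurvature hΦ L) u₀

theorem IsFlowOn.eqOn_Ico {P : PolygonGluing E F} [Finite F] {L k₀ : F → ℝ} {T : ℝ}
    {k k' : ℝ → F → ℝ} (hk : P.IsFlowOn Φ L k₀ (Ico 0 T) k)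
    (hk' : P.IsFlowOn Φ L k₀ (Ico 0 T) k') : EqOn k k' (Ico 0 T) := by
  have := Fintype.ofFinite F
  have hlog := eqOn_Ico_of_isIntegralCurveOn (contDiff_const.sub (P.contDiff_logCurvature hΦ))
    hk.isIntegralCurveOn_log hk'.isIntegralCurveOn_log (by simp only [hk.1, hk'.1])
  exact fun t ht => funext fun f =>
    log_injOn_pos (hk.2 t ht f).1 (hk'.2 t ht f).1 (congrFun (hlog ht) f)

end Bounds

end PolygonGluing

end CirclePattern

theorem theorem1p7 {E F S : Type*} [Fintype E] [Fintype F] [TopologicalSpace S]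
    (D : CirclePattern.CellularDecomposition E F S)
    (Φ : E → ℝ) (hΦ : ∀ e, Φ e ∈ Set.Ioo 0 (Real.pi / 2))
    (Lhat : F → ℝ) (hL : Lhat ∈ D.admissible Φ) :
    ∃ khat : F → ℝ,
      D.HasTotalCurvature Φ Lhat khat ∧
      (∀ k : F → ℝ, D.HasTotalCurvature Φ Lhat k → k = khat) ∧
      ∀ k₀ : F → ℝ, (∀ f, 0 < k₀ f) →
        ∃ k : ℝ → F → ℝ,
          D.IsFlowOn Φ Lhat k₀ (Set.Ici 0) k ∧
          (∀ T : ℝ, 0 < T → ∀ k' : ℝ → F → ℝ,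
            D.IsFlowOn Φ Lhat k₀ (Set.Ico 0 T) k' → Set.EqOn k' k (Set.Ico 0 T)) ∧
          Filter.Tendsto k Filter.atTop (𝓝 khat) := by
  obtain ⟨u, rfl⟩ := D.exists_logCurvature_eq hΦ hL
  refine ⟨fun f => Real.exp (u f), ⟨fun f => Real.exp_pos _, fun f => rfl⟩,
    fun k hk => D.eq_exp_of_hasTotalCurvature hΦ hk, fun k₀ hk₀ => ?_⟩
  obtain ⟨w, hw₀, hw⟩ := D.exists_isIntegralCurve_sub_logCurvature hΦ (D.logCurvature Φ u)
    fun f => Real.log (k₀ f)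
  have hinit (f : F) : Real.exp (w 0 f) = k₀ f := by rw [hw₀, Real.exp_log (hk₀ f)]
  have hflow := D.isFlowOn_exp hinit (hw.isIntegralCurveOn (Set.Ici 0))
  have hlim : Filter.Tendsto w Filter.atTop (𝓝 u) := CirclePattern.tendsto_of_isIntegralCurveOn
    (D.offDiagAntitone_logCurvature hΦ) (D.diagStrictMono_logCurvature hΦ) (hw.isIntegralCurveOn _)
  refine ⟨_, hflow, fun T _ k' hk' =>
    hk'.eqOn_Ico hΦ (hflow.mono Set.Ico_subset_Ici_self), ?_⟩
  exact tendsto_pi_nhds.2 fun f => (tendsto_pi_nhds.1 hlim f).rexp
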